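/- A map $f$ between metric spaces is called quasisymmetric if it is injective and there is a homeomorphism $\eta:[0,\infty)\to[0,\infty)$ such that for all triples of distinct points $x,y,z$ and all $t>0$, $\frac{d(x,y)}{d(y,z)}\le t$ implies $\frac{d(f(x),f(y))}{d(f(y),f(z))}\le\eta(t)$. The conformal dimension of a metric space $X$ is $\mathcal{C}\dim X=\inf_f\dim_H f(X)$, the infimum being over all quasisymmetric maps $f$ from $X$ to metric spaces, and $X$ is called minimal for conformal dimension if $\mathcal{C}\dim X=\dim_H X$ (equivalently, $\mathcal{C}\dim X\ge\dim_H X$). Theorem B. Let $E\subset\mathbb{R}$ be a set of conformal dimension $1$ that supports a Borel measure $\lambda$ such that for every $\varepsilon>0$ there is a constant $C=C(\varepsilon)<\infty$ with $$r^{1+\varepsilon}\le C\,\lambda(E\cap B(x,r))\quad\text{and}\quad \lambda(E\cap B(x,r))\le C\,r^{1-\varepsilon}\qquad\text{for all }x\in E\text{ and all }0<r\le 1.$$ Then, with the product metric $\max\{d_E,d_Y\}$, the space $E\times Y$ is minimal for conformal dimension for every compact metric space $Y$, and also for every Borel set $Y\subset\mathbb{R}^n$, $n\ge 0$. -/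

import Mathlib

open MeasureTheory
open scoped NNReal ENNReal

universe u

/-- An injective map `f` between metric spaces is quasisymmetric if there is a homeomorphism
`η : [0, ∞) → [0, ∞)` such that, for all triples of distinct points `x, y, z` and all `t > 0`,
`d(x, y) / d(y, z) ≤ t` implies `d(f x, f y) / d(f y, f z) ≤ η t`.
By injectivity the denominators are nonzero. -/
def IsQuasisymmetric {X Z : Type*} [MetricSpace X] [MetricSpace Z] (f : X → Z) : Prop :=
  Function.Injective f ∧
    ∃ η : ℝ≥0 ≃ₜ ℝ≥0, ∀ x y z : X, x ≠ y → y ≠ z → x ≠ z → ∀ t : ℝ≥0, 0 < t →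
      nndist x y / nndist y z ≤ t → nndist (f x) (f y) / nndist (f y) (f z) ≤ η t

/-- The conformal dimension of a metric space: the infimum of the Hausdorff dimensions of its
quasisymmetric images. As the image `f(X)` can be identified with `X` carrying the pulled back
metric, it is enough to let the target range over the metric spaces in the universe of `X`. -/
noncomputable def conformalDim (X : Type u) [MetricSpace X] : ℝ≥0∞ :=
  ⨅ (Z : Type u) (_ : MetricSpace Z) (f : X → Z) (_ : IsQuasisymmetric f), dimH (Set.range f)

/-- A metric space is minimal for conformal dimension if its conformal dimension equals its
Hausdorff dimension. -/
def IsMinimalForConformalDim (X : Type*) [MetricSpace X] : Prop :=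
  conformalDim X = dimH (Set.univ : Set X)

/-! For nonempty `Y` both sides equal `1 + dimH Y`. The upper bound `dimH_prod_real_le` refines
covers of `Y` by dyadic intervals in `E`. The lower bound `one_add_dimH_le_dimH_range` holds for
every quasisymmetric `f` on `E × Y`, as follows.

Each slice `E × {y}` has image of dimension at least one. Let `t < 1 < a * t`. Points where the
slice map contracts like `r ^ a` at infinitely many scales have `t`-null image
(`hausdorffMeasure_image_contracted_eq_zero`), so the remaining, expanding points have image of
positive `t`-content. By quasisymmetry, expansion along the slice controls all directions: `d(p, p')
≤ C d(f p, f p') ^ (1/a)` near an expanding point `p`.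

Now cover the image of `f` by sets `U i`, and let `V i` be the parameters `y` whose expanding points
meet `U i`. Then `diam (V i)` is at most about `diam (U i) ^ (1/a)`, and every `y` of content at
least `c` carries total weight `∑ diam (U i) ^ t ≥ c` over the `V i` containing it. Such a weighted
cover yields a genuine one (`exists_cover_of_weighted_cover`), so a null image in dimension `t - β +
s/a` forces `Y` to be `s`-null. As `a, t → 1` and `β → 0`, the exponent tends to `1 + s`. -/

section

open Metric Set Filter Topology

/-! ### Dyadic scales and covers of Hausdorff null sets -/

/-- The dyadic scale `2⁻ⁿ`. -/
noncomputable def dyad (n : ℕ) : ℝ≥0∞ := 2⁻¹ ^ n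

lemma dyad_ne_zero (n : ℕ) : dyad n ≠ 0 := by simp [dyad]

lemma dyad_ne_top (n : ℕ) : dyad n ≠ ∞ := by simp [dyad]

lemma dyad_le_one (n : ℕ) : dyad n ≤ 1 := pow_le_one' (by simp) n

lemma dyad_antitone : Antitone dyad := fun _ _ h => pow_le_pow_right_of_le_one' (by simp) h

lemma dyad_tendsto : Tendsto dyad atTop (𝓝 0) :=
  ENNReal.tendsto_pow_atTop_nhds_zero_of_lt_one (by simp)

lemma dyad_eq_ofReal (n : ℕ) : dyad n = ENNReal.ofReal ((2⁻¹ : ℝ) ^ n) := by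
  rw [dyad, ENNReal.ofReal_pow (by norm_num), ENNReal.ofReal_inv_of_pos (by norm_num)]
  simp

lemma dyad_rpow (n : ℕ) (s : ℝ) : dyad n ^ s = ((2⁻¹ : ℝ≥0∞) ^ s) ^ n := by
  rw [dyad, ← ENNReal.rpow_natCast, ← ENNReal.rpow_mul, mul_comm, ENNReal.rpow_mul,
    ENNReal.rpow_natCast]

lemma dyad_succ_rpow (n : ℕ) (s : ℝ) : dyad n ^ s = 2 ^ s * dyad (n + 1) ^ s := by
  rcases le_total 0 s with hs | hs
  · rw [← ENNReal.mul_rpow_of_nonneg _ _ hs, dyad, dyad, pow_succ, mul_comm, mul_assoc,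
      ENNReal.inv_mul_cancel (by simp) (by simp), mul_one]
  · rw [← ENNReal.mul_rpow_of_ne_top (by simp) (dyad_ne_top _), dyad, dyad, pow_succ, mul_comm,
      mul_assoc, ENNReal.inv_mul_cancel (by simp) (by simp), mul_one]

lemma tsum_dyad_rpow_ne_top {s : ℝ} (hs : 0 < s) : ∑' n, dyad n ^ s ≠ ∞ := by
  simp_rw [dyad_rpow]
  rw [ENNReal.tsum_geometric]
  have : (2⁻¹ : ℝ≥0∞) ^ s < 1 := ENNReal.rpow_lt_one (by simp) hs
  simpa [tsub_eq_zero_iff_le] using this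

lemma dyad_rpow_tendsto {s : ℝ} (hs : 0 < s) : Tendsto (fun n => dyad n ^ s) atTop (𝓝 0) := by
  simp_rw [dyad_rpow]
  exact ENNReal.tendsto_pow_atTop_nhds_zero_of_lt_one (ENNReal.rpow_lt_one (by simp) hs)

lemma exists_dyad_near {d : ℝ≥0∞} (h0 : d ≠ 0) (h1 : d ≤ 1) :
    ∃ n, dyad (n + 1) < d ∧ d ≤ dyad n := by
  have hd : d ≠ ∞ := (h1.trans_lt ENNReal.one_lt_top).ne
  obtain ⟨n, hn, hn'⟩ := exists_nat_pow_near_of_lt_one (ENNReal.toReal_pos h0 hd)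
    (ENNReal.toReal_le_of_le_ofReal zero_le_one (by simpa using h1))
    (by norm_num : (0 : ℝ) < 2⁻¹) (by norm_num)
  refine ⟨n, ?_, ?_⟩
  · rw [dyad_eq_ofReal, ENNReal.ofReal_lt_iff_lt_toReal (by positivity) hd]
    exact hn
  · rw [dyad_eq_ofReal]
    exact (ENNReal.le_ofReal_iff_toReal_le hd (by positivity)).2 hn'

/-- Sets of vanishing Hausdorff content are null for the Hausdorff measure. -/
lemma hausdorffMeasure_eq_zero_of_covers {Z : Type*} [EMetricSpace Z] [MeasurableSpace Z]
    [BorelSpace Z] {s : ℝ} (hs : 0 < s) {S : Set Z}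
    (h : ∀ ε : ℝ≥0∞, ε ≠ 0 → ∃ (ι : Type*) (_ : Countable ι) (U : ι → Set Z), S ⊆ ⋃ i, U i ∧
      ∑' i, ediam (U i) ^ s ≤ ε) : μH[s] S = 0 := by
  have he : ∀ n, dyad n ^ s ≠ 0 := fun n => by
    simp [ENNReal.rpow_eq_zero_iff, dyad_ne_zero, dyad_ne_top]
  choose ι hι U hU hsum using fun n => h (dyad n ^ s) (he n)
  refine le_antisymm ?_ bot_le
  have key := Measure.hausdorffMeasure_le_liminf_tsum s S dyad dyad_tendsto U
    (.of_forall fun n i => ?_) (.of_forall hU)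
  · refine key.trans ((liminf_le_liminf (.of_forall hsum)).trans ?_)
    exact (dyad_rpow_tendsto hs).liminf_eq.le
  -- A single term is at most the whole sum, so small content already forces small diameters.
  · rw [← ENNReal.rpow_le_rpow_iff hs]
    exact (ENNReal.le_tsum i).trans (hsum n)

/-- A null set for the Hausdorff measure has covers by sets with small dyadic size bounds. -/
lemma exists_dyad_cover_of_hausdorffMeasure_eq_zero {Z : Type*} [EMetricSpace Z]
    [MeasurableSpace Z] [BorelSpace Z] {q : ℝ} (hq : 0 < q) {S : Set Z} (h : μH[q] S = 0)
    {ε : ℝ≥0∞} (hε : ε ≠ 0) (n₀ : ℕ) :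
    ∃ (U : ℕ → Set Z) (J : ℕ → ℕ), S ⊆ ⋃ i, U i ∧ (∀ i, ediam (U i) ≤ dyad (J i)) ∧
      (∀ i, n₀ ≤ J i) ∧ ∑' i, dyad (J i) ^ q ≤ ε := by
  have h2 : (2 : ℝ≥0∞) ^ q ≠ ∞ := ENNReal.rpow_ne_top_of_nonneg hq.le (by simp)
  obtain ⟨δ, hδ, hδsum⟩ := ENNReal.exists_pos_sum_of_countable (ENNReal.half_pos hε).ne' ℕ
  have hε' : 0 < ε / 2 / 2 ^ q := ENNReal.div_pos (ENNReal.half_pos hε).ne' h2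
  rw [Measure.hausdorffMeasure_apply] at h
  have h0 := (iSup₂_le_iff.1 h.le) (dyad n₀) (pos_iff_ne_zero.2 (dyad_ne_zero _))
  have h1 := h0.trans_lt hε'
  simp only [iInf_lt_iff] at h1
  obtain ⟨U, hSU, hUd, hsum⟩ := h1
  have hsum' : ∑' i, ediam (U i) ^ q ≤ ε / 2 / 2 ^ q := by
    refine le_trans (ENNReal.tsum_le_tsum fun i => ?_) hsum.le
    rcases (U i).eq_empty_or_nonempty with he | hne
    · simp [he, hq]
    · simp [hne]
  -- Rounding a diameter up to a dyadic scale costs the factor `2 ^ q`; `δ i` pays for sets of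
  -- diameter zero.
  have key : ∀ i, ∃ j, n₀ ≤ j ∧ ediam (U i) ≤ dyad j ∧
      dyad j ^ q ≤ 2 ^ q * ediam (U i) ^ q + δ i := by
    intro i
    by_cases h0 : ediam (U i) = 0
    · obtain ⟨j, hj1, hj2⟩ := (((dyad_rpow_tendsto hq).eventually_lt_const
        (ENNReal.coe_pos.2 (hδ i))).and (eventually_ge_atTop n₀)).exists
      exact ⟨j, hj2, by simp [h0], hj1.le.trans le_add_self⟩
    · obtain ⟨j, hj1, hj2⟩ := exists_dyad_near h0 ((hUd i).trans (dyad_le_one _))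
      refine ⟨max n₀ j, le_max_left _ _, ?_, ?_⟩
      · rcases max_choice n₀ j with h | h <;> rw [h]
        exacts [hUd i, hj2]
      · refine le_trans ?_ le_self_add
        calc dyad (max n₀ j) ^ q ≤ dyad j ^ q :=
              ENNReal.rpow_le_rpow (dyad_antitone (le_max_right _ _)) hq.le
          _ = 2 ^ q * dyad (j + 1) ^ q := dyad_succ_rpow _ _
          _ ≤ _ := by gcongr
  choose J hJ1 hJ2 hJ3 using key
  refine ⟨U, J, hSU, hJ2, hJ1, ?_⟩
  calc ∑' i, dyad (J i) ^ q ≤ ∑' i, (2 ^ q * ediam (U i) ^ q + δ i) := ENNReal.tsum_le_tsum hJ3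
    _ = 2 ^ q * ∑' i, ediam (U i) ^ q + ∑' i, (δ i : ℝ≥0∞) := by
      rw [ENNReal.tsum_add, ENNReal.tsum_mul_left]
    _ ≤ 2 ^ q * (ε / 2 / 2 ^ q) + ε / 2 := by gcongr
    _ = ε := by
      rw [ENNReal.mul_div_cancel (by simp [ENNReal.rpow_eq_zero_iff]) h2, ENNReal.add_halves]

/-! ### Upper bound for the dimension of the product -/

/-- The position of the dyadic interval of generation `n` containing `u`, inside the unit
interval `[⌊u⌋, ⌊u⌋ + 1)`. -/
noncomputable def dyadicPos (n : ℕ) (u : ℝ) : Fin (2 ^ n) :=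
  ⟨⌊Int.fract u * 2 ^ n⌋₊, by
    rw [Nat.floor_lt (by have := Int.fract_nonneg u; positivity)]
    push_cast
    have := Int.fract_lt_one u
    nlinarith [show (0 : ℝ) < 2 ^ n by positivity]⟩

lemma edist_le_dyad_of_dyadicPos_eq {n : ℕ} {u v : ℝ} (h : ⌊u⌋ = ⌊v⌋)
    (h' : dyadicPos n u = dyadicPos n v) : edist u v ≤ dyad n := by
  have hu := Int.floor_add_fract u
  have hv := Int.floor_add_fract v
  have e : ⌊Int.fract u * 2 ^ n⌋₊ = ⌊Int.fract v * 2 ^ n⌋₊ := congrArg Fin.val h'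
  have h2 : (0 : ℝ) < 2 ^ n := by positivity
  have hu0 : 0 ≤ Int.fract u * 2 ^ n := mul_nonneg (Int.fract_nonneg u) h2.le
  have hv0 : 0 ≤ Int.fract v * 2 ^ n := mul_nonneg (Int.fract_nonneg v) h2.le
  have a1 := Nat.floor_le hu0
  have a2 := Nat.lt_floor_add_one (Int.fract u * 2 ^ n)
  have b1 := Nat.floor_le hv0
  have b2 := Nat.lt_floor_add_one (Int.fract v * 2 ^ n)
  rw [e] at a1 a2
  rw [edist_dist, dyad_eq_ofReal]
  refine ENNReal.ofReal_le_ofReal ?_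
  have hd : u - v = Int.fract u - Int.fract v := by
    rw [h] at hu; linarith
  have h1 : |(Int.fract u - Int.fract v) * 2 ^ n| ≤ 1 := by
    rw [abs_le]
    constructor <;> nlinarith
  rw [Real.dist_eq, hd, inv_pow, ← one_div, le_div_iff₀ h2]
  rwa [abs_mul, abs_of_pos h2] at h1

lemma two_pow_mul_dyad (n : ℕ) : (2 : ℝ≥0∞) ^ n * dyad n = 1 := by
  rw [dyad, ← mul_pow, ENNReal.mul_inv_cancel (by simp) (by simp), one_pow]

/-- Over a unit interval, a set of size `2⁻ʲ` in `Y` is multiplied by `2ʲ` dyadic intervals of its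
own size, and `2ʲ * 2^(-j(1+s)) = 2^(-js)`. -/
lemma hausdorffMeasure_prod_real_eq_zero {Y : Type*} [MetricSpace Y] [MeasurableSpace Y]
    [BorelSpace Y] (E : Set ℝ) [MeasurableSpace (E × Y)] [BorelSpace (E × Y)] {s : ℝ} (hs : 0 < s)
    (h : μH[s] (univ : Set Y) = 0) : μH[1 + s] (univ : Set (E × Y)) = 0 := by
  have huniv : (univ : Set (E × Y)) = ⋃ m : ℤ, {p | ⌊(p.1 : ℝ)⌋ = m} := by
    ext p; simp
  rw [huniv]
  refine measure_iUnion_null fun m => hausdorffMeasure_eq_zero_of_covers (by positivity) ?_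
  intro ε hε
  obtain ⟨U, J, hU, hUJ, -, hsum⟩ := exists_dyad_cover_of_hausdorffMeasure_eq_zero hs h hε 0
  refine ⟨Σ i : ℕ, Fin (2 ^ J i), inferInstance, fun p =>
    {z | ⌊(z.1 : ℝ)⌋ = m ∧ dyadicPos (J p.1) z.1 = p.2 ∧ z.2 ∈ U p.1}, ?_, ?_⟩
  · intro z hz
    obtain ⟨i, hi⟩ := mem_iUnion.1 (hU (mem_univ z.2))
    exact mem_iUnion.2 ⟨⟨i, dyadicPos (J i) z.1⟩, hz, rfl, hi⟩
  · rw [ENNReal.tsum_sigma']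
    refine le_trans (ENNReal.tsum_le_tsum fun i => ?_) hsum
    calc _ ≤ ∑' _ : Fin (2 ^ J i), dyad (J i) ^ (1 + s) := by
          refine ENNReal.tsum_le_tsum fun k => ENNReal.rpow_le_rpow ?_ (by positivity)
          refine ediam_le fun z hz w hw => ?_
          rw [Prod.edist_eq]
          refine max_le ?_ (edist_le_of_ediam_le hz.2.2 hw.2.2 (hUJ i))
          exact edist_le_dyad_of_dyadicPos_eq (hz.1.trans hw.1.symm) (hz.2.1.trans hw.2.1.symm)
      _ = dyad (J i) ^ s := by
          rw [ENNReal.rpow_add _ _ (dyad_ne_zero _) (dyad_ne_top _), ENNReal.rpow_one]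
          simp [tsum_fintype, ← mul_assoc, two_pow_mul_dyad]

lemma dimH_prod_real_le {Y : Type*} [MetricSpace Y] (E : Set ℝ) :
    dimH (univ : Set (E × Y)) ≤ 1 + dimH (univ : Set Y) := by
  by_contra! hlt
  obtain ⟨c, hc1, hc2⟩ := ENNReal.lt_iff_exists_nnreal_btwn.1 hlt
  have h1c : (1 : ℝ≥0) ≤ c := by
    have : (1 : ℝ≥0∞) ≤ c := le_self_add.trans hc1.le
    exact_mod_cast this
  obtain ⟨s, rfl⟩ := exists_add_of_le h1c
  have hs : dimH (univ : Set Y) < s := by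
    rw [ENNReal.coe_add, ENNReal.coe_one] at hc1
    exact lt_of_add_lt_add_left hc1
  have hs0 : 0 < s := ENNReal.coe_pos.1 (bot_le.trans_lt hs)
  borelize Y
  borelize (E × Y)
  have h0 := hausdorffMeasure_prod_real_eq_zero E (NNReal.coe_pos.2 hs0)
    (hausdorffMeasure_of_dimH_lt hs)
  have htop := hausdorffMeasure_of_lt_dimH hc2
  rw [NNReal.coe_add, NNReal.coe_one, h0] at htop
  exact ENNReal.zero_ne_top htop

/-! ### Images of strongly contracted points -/

/-- Points around which a map contracts infinitely often more than with exponent `a > 1` have an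
image of small dimension. -/
lemma hausdorffMeasure_image_contracted_eq_zero {E : Set ℝ} {Z : Type*} [EMetricSpace Z]
    [MeasurableSpace Z] [BorelSpace Z] (g : E → Z) {a t : ℝ} (ht : 0 < t) (hat : 1 < a * t) :
    μH[t] (g '' {x | ∀ n₀, ∃ n ≥ n₀, ediam (g '' closedEBall x (dyad n)) ≤ dyad n ^ a}) = 0 := by
  set bad := {x | ∀ n₀, ∃ n ≥ n₀, ediam (g '' closedEBall x (dyad n)) ≤ dyad n ^ a}
  have hbad : g '' bad = ⋃ m : ℤ, g '' {x ∈ bad | ⌊(x : ℝ)⌋ = m} := by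
    rw [← image_iUnion]; congr 1; ext p; simp
  rw [hbad]
  refine measure_iUnion_null fun m => hausdorffMeasure_eq_zero_of_covers ht ?_
  intro ε hε
  -- Generation `n` contributes `2ⁿ` intervals, each with image of size at most `2^(-na)`; the tails
  -- of this series bound the content.
  have hsm : ∑' n, dyad n ^ (a * t - 1) ≠ ∞ := tsum_dyad_rpow_ne_top (by linarith)
  obtain ⟨n₀, hn₀⟩ := ((ENNReal.tendsto_sum_nat_add _ hsm).eventually_lt_const
    (pos_iff_ne_zero.2 hε)).exists
  refine ⟨Σ n : ℕ, Fin (2 ^ (n + n₀)), inferInstance, fun p => g '' {x | ⌊(x : ℝ)⌋ = m ∧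
    dyadicPos (p.1 + n₀) x = p.2 ∧
      ediam (g '' closedEBall x (dyad (p.1 + n₀))) ≤ dyad (p.1 + n₀) ^ a}, ?_, ?_⟩
  · rintro _ ⟨x, ⟨hx, hm⟩, rfl⟩
    obtain ⟨n, hn, hd⟩ := hx n₀
    obtain ⟨k, rfl⟩ := Nat.exists_eq_add_of_le' hn
    exact mem_iUnion.2 ⟨⟨k, dyadicPos (k + n₀) x⟩, x, ⟨hm, rfl, hd⟩, rfl⟩
  · rw [ENNReal.tsum_sigma']
    refine le_trans (ENNReal.tsum_le_tsum fun n => ?_) hn₀.le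
    calc _ ≤ ∑' _ : Fin (2 ^ (n + n₀)), (dyad (n + n₀) ^ a) ^ t := by
          refine ENNReal.tsum_le_tsum fun k => ENNReal.rpow_le_rpow ?_ ht.le
          refine ediam_le ?_
          rintro _ ⟨x, hx, rfl⟩ _ ⟨w, hw, rfl⟩
          refine edist_le_of_ediam_le (mem_image_of_mem g ?_) (mem_image_of_mem g ?_) hx.2.2
          · exact mem_closedEBall_self
          · exact edist_le_dyad_of_dyadicPos_eq (hw.1.trans hx.1.symm)
              (hw.2.1.trans hx.2.1.symm)
      _ = dyad (n + n₀) ^ (a * t - 1) := by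
          rw [← ENNReal.rpow_mul, show a * t = 1 + (a * t - 1) by ring,
            ENNReal.rpow_add _ _ (dyad_ne_zero _) (dyad_ne_top _), ENNReal.rpow_one]
          simp [tsum_fintype, ← mul_assoc, two_pow_mul_dyad]

/-! ### From weighted covers to covers -/

/-- A set each of whose points lies in at least `m` members of a family of sets of diameter at
most `R` is covered by few balls of radius `R`. -/
lemma exists_finset_cover_of_multiplicity {Y ι : Type*} [PseudoEMetricSpace Y] {A : Set Y}
    {V : ι → Set Y} {R m : ℝ≥0∞} (hm : m ≠ 0) (hι : ∑' _ : ι, (1 : ℝ≥0∞) ≠ ∞)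
    (hV : ∀ i, ediam (V i) ≤ R)
    (hA : ∀ y ∈ A, m ≤ ∑' i, (V i).indicator 1 y) :
    ∃ L : Finset Y, A ⊆ ⋃ y ∈ L, closedEBall y R ∧ L.card * m ≤ ∑' _ : ι, (1 : ℝ≥0∞) := by
  classical
  have bound : ∀ L : Finset Y, (L : Set Y) ⊆ A → (L : Set Y).Pairwise (R < edist · ·) →
      L.card * m ≤ ∑' _ : ι, (1 : ℝ≥0∞) := by
    intro L hLA hL
    calc (L.card : ℝ≥0∞) * m = ∑ y ∈ L, m := by simp
      _ ≤ ∑ y ∈ L, ∑' i, (V i).indicator 1 y := Finset.sum_le_sum fun y hy => hA y (hLA hy)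
      _ = ∑' i, ∑ y ∈ L, (V i).indicator 1 y :=
        (Summable.tsum_finsetSum fun _ _ => ENNReal.summable).symm
      _ ≤ _ := by
        refine ENNReal.tsum_le_tsum fun i => ?_
        -- Points of `L` are more than `R` apart, so each `V i` contains at most one of them.
        by_cases h : ∃ y ∈ L, y ∈ V i
        · obtain ⟨y, hy, hyV⟩ := h
          rw [Finset.sum_eq_single y]
          · simp [hyV]
          · intro z hz hne
            refine indicator_of_notMem (fun hzV => ?_) _
            exact (hL hz hy hne).not_ge (edist_le_of_ediam_le hzV hyV (hV i))
          · exact fun h => absurd hy h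
        · push Not at h
          rw [Finset.sum_eq_zero fun y hy => indicator_of_notMem (h y hy) _]
          exact zero_le_one
  have hbdd : ∃ K : ℕ, ∀ L : Finset Y, (L : Set Y) ⊆ A → (L : Set Y).Pairwise (R < edist · ·) →
      L.card ≤ K := by
    have htop : (∑' _ : ι, (1 : ℝ≥0∞)) / m ≠ ∞ := ENNReal.div_ne_top hι hm
    obtain ⟨K, hK⟩ := ENNReal.exists_nat_gt htop
    refine ⟨K, fun L h1 h2 => ?_⟩
    have h3 : (L.card : ℝ≥0∞) ≤ (∑' _ : ι, (1 : ℝ≥0∞)) / m :=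
      (ENNReal.le_div_iff_mul_le (.inl hm) (.inr hι)).2 (bound L h1 h2)
    exact_mod_cast h3.trans hK.le
  obtain ⟨K, hK⟩ := hbdd
  -- A separated set of maximal cardinality is an `R`-net.
  let P : ℕ → Prop := fun n => ∃ L : Finset Y, (L : Set Y) ⊆ A ∧
    (L : Set Y).Pairwise (R < edist · ·) ∧ L.card = n
  have hP0 : P 0 := ⟨∅, by simp, by simp, rfl⟩
  obtain ⟨L, hLA, hL, hcard⟩ : P (Nat.findGreatest P K) :=
    Nat.findGreatest_spec (Nat.zero_le K) hP0
  refine ⟨L, fun y hy => ?_, bound L hLA hL⟩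
  by_contra hcon
  simp only [mem_iUnion, mem_closedEBall, not_exists, not_le] at hcon
  have hyL : y ∉ L := fun h => by simpa using hcon y h
  have h1 : P (L.card + 1) := by
    refine ⟨insert y L, ?_, ?_, by simp [hyL]⟩
    · rw [Finset.coe_insert]; exact insert_subset hy hLA
    · rw [Finset.coe_insert]
      refine hL.insert fun z hz _ => ⟨hcon z hz, ?_⟩
      rw [edist_comm]; exact hcon z hz
  have h2 : L.card + 1 ≤ K := by
    obtain ⟨L', h1, h2, h3⟩ := h1
    exact h3 ▸ hK L' h1 h2
  have := Nat.le_findGreatest h2 h1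
  omega

/-- A weighted cover by sets of small diameter gives rise to a cover with small content of
dimension `s`, at the cost of an arbitrarily small loss `β` in the weights. -/
lemma exists_cover_of_weighted_cover {Y ι : Type*} [PseudoEMetricSpace Y] {A : Set Y}
    {V : ι → Set Y} {J : ι → ℕ} {C c B : ℝ≥0∞} {b s t β : ℝ} (hc : c ≠ 0) (hct : c ≠ ∞)
    (hs : 0 < s) (hB : ∑' j, dyad j ^ β ≤ B) (hB0 : B ≠ 0) (hBt : B ≠ ∞)
    (hV : ∀ i, ediam (V i) ≤ C * dyad (J i) ^ b)
    (hA : ∀ y ∈ A, c ≤ ∑' i, (V i).indicator 1 y * dyad (J i) ^ t)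
    (hfin : ∑' i, dyad (J i) ^ (t - β + b * s) ≠ ∞) :
    ∃ (L : ℕ → Finset Y) (W : (Σ j, L j) → Set Y), A ⊆ ⋃ p, W p ∧
      ∑' p, ediam (W p) ^ s ≤
        (2 * C) ^ s * (c / (2 * B))⁻¹ * ∑' i, dyad (J i) ^ (t - β + b * s) := by
  set c' := c / (2 * B) with hc'
  have h2B : 2 * B ≠ ∞ := ENNReal.mul_ne_top (by simp) hBt
  have h2B0 : 2 * B ≠ 0 := mul_ne_zero (by simp) hB0
  have hc'0 : c' ≠ 0 := (ENNReal.div_pos hc h2B).ne'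
  have hc't : c' ≠ ∞ := ENNReal.div_ne_top hct h2B0
  have d0 : ∀ j (r : ℝ), dyad j ^ r ≠ 0 := fun j r => by
    simp [ENNReal.rpow_eq_zero_iff, dyad_ne_zero, dyad_ne_top]
  have dt : ∀ j (r : ℝ), dyad j ^ r ≠ ∞ := fun j r =>
    ENNReal.rpow_ne_top_of_ne_zero (dyad_ne_zero j) (dyad_ne_top j)
  have dadd : ∀ j (r r' : ℝ), dyad j ^ (r + r') = dyad j ^ r * dyad j ^ r' := fun j r r' =>
    ENNReal.rpow_add _ _ (dyad_ne_zero j) (dyad_ne_top j)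
  set q := t - β + b * s with hq
  -- the multiplicity of `y` at scale `j`
  let w : Y → ℕ → ℝ≥0∞ := fun y j => ∑' i : J ⁻¹' {j}, (V i).indicator 1 y
  let N : ℕ → ℝ≥0∞ := fun j => ∑' _ : J ⁻¹' {j}, 1
  have hNsum : ∑' j, N j * dyad j ^ q = ∑' i, dyad (J i) ^ q := by
    rw [← ENNReal.tsum_fiberwise _ J]
    refine tsum_congr fun j => ?_
    rw [← ENNReal.tsum_mul_right]
    exact tsum_congr fun i => by rw [one_mul, show J i = j from i.2]
  have hN : ∀ j, N j ≠ ∞ := fun j hj => hfin <| by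
    rw [← hNsum]
    exact ENNReal.tsum_eq_top_of_eq_top ⟨j, by rw [hj, ENNReal.top_mul (d0 j q)]⟩
  -- Pigeonhole over scales: otherwise the total weight at `y` would be at most `c' * B = c / 2`.
  have hsel : ∀ y ∈ A, ∃ j, c' * dyad j ^ (β - t) ≤ w y j := by
    intro y hy
    by_contra! hcon
    have h1 : ∑' i, (V i).indicator 1 y * dyad (J i) ^ t = ∑' j, w y j * dyad j ^ t := by
      rw [← ENNReal.tsum_fiberwise _ J]
      refine tsum_congr fun j => ?_
      rw [← ENNReal.tsum_mul_right]
      exact tsum_congr fun i => by rw [show J i = j from i.2]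
    have h2 : ∑' j, w y j * dyad j ^ t ≤ ∑' j, c' * dyad j ^ β := by
      refine ENNReal.tsum_le_tsum fun j => ?_
      calc w y j * dyad j ^ t ≤ c' * dyad j ^ (β - t) * dyad j ^ t := by
            gcongr; exact (hcon j).le
        _ = _ := by rw [mul_assoc, ← dadd]; congr 2; ring
    have h3 : ∑' j, c' * dyad j ^ β ≤ c / 2 := by
      rw [ENNReal.tsum_mul_left]
      calc c' * ∑' j, dyad j ^ β ≤ c' * B := by gcongr
        _ = c / 2 := by
          rw [hc', ENNReal.div_eq_inv_mul, ENNReal.div_eq_inv_mul,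
            ENNReal.mul_inv (by simp) (by simp), mul_assoc, mul_assoc, mul_comm c B, ← mul_assoc B⁻¹,
            ENNReal.inv_mul_cancel hB0 hBt, one_mul]
    exact ((hA y hy).trans (h1.le.trans (h2.trans h3))).not_gt (ENNReal.half_lt_self hc hct)
  have hcov : ∀ j, ∃ L : Finset Y, {y | c' * dyad j ^ (β - t) ≤ w y j} ⊆
      ⋃ y ∈ L, closedEBall y (C * dyad j ^ b) ∧ L.card * (c' * dyad j ^ (β - t)) ≤ N j := by
    intro j
    refine exists_finset_cover_of_multiplicity (V := fun i : J ⁻¹' {j} => V i)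
      (mul_ne_zero hc'0 (d0 _ _)) (hN j) (fun i => ?_) (fun y hy => hy)
    have := hV i
    rwa [show J i = j from i.2] at this
  choose L hL hcard using hcov
  refine ⟨L, fun p => closedEBall (p.2 : Y) (C * dyad p.1 ^ b), fun y hy => ?_, ?_⟩
  · obtain ⟨j, hj⟩ := hsel y hy
    obtain ⟨z, hz, hyz⟩ := mem_iUnion₂.1 (hL j hj)
    exact mem_iUnion.2 ⟨⟨j, z, hz⟩, hyz⟩
  · rw [ENNReal.tsum_sigma', ← hNsum, ← ENNReal.tsum_mul_left]
    refine ENNReal.tsum_le_tsum fun j => ?_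
    have hcj : (L j).card ≤ c'⁻¹ * dyad j ^ (t - β) * N j := by
      calc ((L j).card : ℝ≥0∞)
          = c'⁻¹ * dyad j ^ (t - β) * ((L j).card * (c' * dyad j ^ (β - t))) := by
            have e1 : dyad j ^ (t - β) * dyad j ^ (β - t) = 1 := by
              rw [← dadd]; simp
            have e2 := ENNReal.inv_mul_cancel hc'0 hc't
            calc ((L j).card : ℝ≥0∞)
                = (c'⁻¹ * c') * (dyad j ^ (t - β) * dyad j ^ (β - t)) * (L j).card := by
                  rw [e1, e2]; simp
              _ = _ := by ring
        _ ≤ _ := by gcongr; exact hcard j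
    calc ∑' z : L j, ediam (closedEBall (z : Y) (C * dyad j ^ b)) ^ s
        ≤ ∑' _ : L j, ((2 * C) * dyad j ^ b) ^ s := by
          refine ENNReal.tsum_le_tsum fun z => ENNReal.rpow_le_rpow ?_ hs.le
          rw [mul_assoc]
          exact ediam_closedEBall_le
      _ = (L j).card * ((2 * C) ^ s * dyad j ^ (b * s)) := by
          rw [ENNReal.mul_rpow_of_nonneg _ _ hs.le, ← ENNReal.rpow_mul]
          simp [tsum_fintype]
      _ ≤ c'⁻¹ * dyad j ^ (t - β) * N j * ((2 * C) ^ s * dyad j ^ (b * s)) := by gcongr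
      _ = (2 * C) ^ s * c'⁻¹ * (N j * dyad j ^ q) := by
          rw [hq, dadd]; ring

/-! ### Quasisymmetric maps -/

namespace IsQuasisymmetric

variable {X Z : Type*} [MetricSpace X] [MetricSpace Z] {f : X → Z}

lemma comp_isometry {X' : Type*} [MetricSpace X'] (hf : IsQuasisymmetric f) {g : X' → X}
    (hg : Isometry g) : IsQuasisymmetric (f ∘ g) := by
  obtain ⟨hinj, η, hη⟩ := hf
  refine ⟨hinj.comp hg.injective, η, fun x y z hxy hyz hxz t ht h => ?_⟩
  refine hη (g x) (g y) (g z) (hg.injective.ne hxy) (hg.injective.ne hyz) (hg.injective.ne hxz)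
    t ht ?_
  rwa [hg.nndist_eq, hg.nndist_eq]

lemma id_self : IsQuasisymmetric (id : X → X) :=
  ⟨Function.injective_id, Homeomorph.refl _, fun _ _ _ _ _ _ _ _ h => h⟩

/-- A quasisymmetric map distorts distances to a common point in a controlled manner. -/
lemma exists_edist_le (hf : IsQuasisymmetric f) :
    ∃ H : ℝ≥0, ∀ w p p', edist w p ≤ edist p p' → edist (f w) (f p) ≤ H * edist (f p) (f p') := by
  obtain ⟨hinj, η, hη⟩ := hf
  -- The `1` serves the degenerate case `w = p'`, where the condition on distinct triples says
  -- nothing.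
  refine ⟨max 1 (η 1), fun w p p' h => ?_⟩
  simp only [edist_nndist] at h ⊢
  norm_cast at h ⊢
  by_cases hpp : p = p'
  · subst hpp
    have : nndist w p = 0 := by simpa using h
    simp [nndist_eq_zero.1 this]
  by_cases hwp : w = p
  · simp [hwp]
  have hpos : 0 < nndist (f p) (f p') := by
    rw [pos_iff_ne_zero, Ne, nndist_eq_zero]; exact hinj.ne hpp
  by_cases hwp' : w = p'
  · subst hwp'
    rw [nndist_comm]
    exact le_mul_of_one_le_left' (le_max_left _ _)
  have hpos' : 0 < nndist p p' := by rw [pos_iff_ne_zero, Ne, nndist_eq_zero]; exact hpp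
  have := hη w p p' hwp hpp hwp' 1 one_pos (div_le_one_of_le₀ h bot_le)
  rw [div_le_iff₀ hpos] at this
  exact this.trans (by gcongr; exact le_max_right _ _)

/-- The inverse of a quasisymmetric map is uniformly continuous over bounded sets. -/
lemma exists_edist_le_of_edist_le (hf : IsQuasisymmetric f) {W : Set X}
    (hW : Bornology.IsBounded W) {κ : ℝ≥0∞} (hκ : κ ≠ 0) :
    ∃ τ : ℝ≥0∞, τ ≠ 0 ∧ ∀ p ∈ W, ∀ p' ∈ W, edist (f p) (f p') ≤ τ → edist p p' ≤ κ := by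
  by_cases htriv : ∀ p ∈ W, ∀ p' ∈ W, edist p p' ≤ κ
  · exact ⟨1, one_ne_zero, fun p hp p' hp' _ => htriv p hp p' hp'⟩
  push Not at htriv
  obtain ⟨a, ha, b, hb, hab⟩ := htriv
  obtain ⟨hinj, η, hη⟩ := hf
  have hκt : κ ≠ ∞ := (hab.trans_le le_top).ne
  lift κ to ℝ≥0 using hκt
  have hκ0 : 0 < κ := pos_iff_ne_zero.2 (by simpa using hκ)
  have hne : a ≠ b := by rintro rfl; simp at hab
  have hD : 0 < nndist (f a) (f b) := by
    rw [pos_iff_ne_zero, Ne, nndist_eq_zero]; exact hinj.ne hne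
  set D := nndist (f a) (f b) / 2 with hDdef
  have hD0 : 0 < D := half_pos hD
  obtain ⟨M, hM⟩ := isBounded_iff_nndist.1 hW
  -- `T` bounds `d(e, p) / d(p, p')` for `e, p ∈ W` once `d(p, p') > κ`; `τ` is chosen so that `η T
  -- * τ < D`, while `f a` or `f b` is at distance at least `D` from `f p`.
  set T := (M + 1) / κ
  have hT : 0 < T := by positivity
  set τ := min (D / 2) (D / (2 * (η T + 1)))
  have hτ : 0 < τ := by positivity
  refine ⟨τ, by simpa using hτ.ne', fun p hp p' hp' h => ?_⟩
  by_contra! hlt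
  rw [edist_nndist] at h hlt
  norm_cast at h hlt
  have hpp : p ≠ p' := by rintro rfl; simp at hlt
  obtain ⟨e, he, hed⟩ : ∃ e ∈ W, D ≤ nndist (f e) (f p) := by
    by_contra! hcon
    have h1 := hcon a ha
    have h2 := hcon b hb
    have h3 := nndist_triangle (f a) (f p) (f b)
    rw [nndist_comm (f p)] at h3
    have := h3.trans_lt (add_lt_add h1 h2)
    rw [hDdef, add_halves] at this
    exact lt_irrefl _ this
  have hep : e ≠ p := by rintro rfl; simp at hed; exact hD0.ne' hed
  have hpos : 0 < nndist (f p) (f p') := by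
    rw [pos_iff_ne_zero, Ne, nndist_eq_zero]; exact hinj.ne hpp
  by_cases hep' : e = p'
  · subst hep'
    rw [nndist_comm] at h
    exact (hed.trans (h.trans (min_le_left _ _))).not_gt (half_lt_self hD0)
  have key := hη e p p' hep hpp hep' T hT (div_le_div₀ bot_le
    ((hM he hp).trans (le_add_of_nonneg_right zero_le_one)) hκ0 hlt.le)
  rw [div_le_iff₀ hpos] at key
  have : D ≤ η T * (D / (2 * (η T + 1))) :=
    hed.trans (key.trans (by gcongr; exact h.trans (min_le_right _ _)))
  have h2 : η T * (D / (2 * (η T + 1))) < D := by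
    rw [← mul_div_assoc, div_lt_iff₀ (by positivity)]
    calc η T * D < (2 * (η T + 1)) * D := by
          gcongr
          calc η T < η T + 1 := lt_add_one _
            _ ≤ _ := le_mul_of_one_le_left' (by norm_num)
      _ = _ := mul_comm _ _
  exact this.not_gt h2

end IsQuasisymmetric

/-- Every quasisymmetric map to a metric space, in any universe, bounds the conformal dimension. -/
lemma conformalDim_le_dimH_range {X : Type*} {Z : Type*} [mX : MetricSpace X] [mZ : MetricSpace Z]
    {g : X → Z} (hg : IsQuasisymmetric g) : conformalDim X ≤ dimH (range g) := by
  let m : MetricSpace X := MetricSpace.induced g hg.1 mZ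
  have hid : @IsQuasisymmetric X X mX m id := by
    obtain ⟨hinj, η, hη⟩ := hg
    exact ⟨Function.injective_id, η, hη⟩
  have hiso : @Isometry X Z m.toPseudoMetricSpace.toPseudoEMetricSpace _ g := fun _ _ => rfl
  have hdim := @Isometry.dimH_image X Z (@MetricSpace.toEMetricSpace X m) _ g hiso (range id)
  refine (iInf₂_le_of_le X m (iInf₂_le_of_le id hid le_rfl)).trans ?_
  rw [← hdim, range_id, image_univ]

/-! ### Expanding points of slices and the lower bound -/

/-- The points `x` of a bounded part of the slice `E × {y}` around which the restriction of `f` to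
the slice expands, from the scale `2⁻ᵏ` on, at least like `r ↦ r ^ a`. -/
def sliceExpanding {E : Set ℝ} {Y Z : Type*} [MetricSpace Y] [MetricSpace Z] (f : E × Y → Z)
    (p₀ : E × Y) (a : ℝ) (k : ℕ) (y : Y) : Set E :=
  {x | (x, y) ∈ closedBall p₀ k ∧
    ∀ n ≥ k, dyad n ^ a < ediam ((fun x => f (x, y)) '' closedEBall x (dyad n))}

section

variable {E : Set ℝ} {Y Z : Type*} [MetricSpace Y] [MetricSpace Z] {f : E × Y → Z}

lemma IsQuasisymmetric.slice (hf : IsQuasisymmetric f) (y : Y) :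
    IsQuasisymmetric fun x => f (x, y) :=
  hf.comp_isometry (g := fun x => (x, y)) fun _ _ => by simp [Prod.edist_eq]

/-- The slice has image of infinite `t`-measure, and it is the union of its contracted points, whose
image is null, and countably many expanding parts. -/
lemma exists_hausdorffMeasure_image_sliceExpanding_ne_zero [MeasurableSpace Z] [BorelSpace Z]
    (hE : 1 ≤ conformalDim E) (hf : IsQuasisymmetric f) (p₀ : E × Y) {a t : ℝ} (ht : 0 < t)
    (ht1 : t < 1) (hat : 1 < a * t) (y : Y) :
    ∃ k, μH[t] ((fun x => f (x, y)) '' sliceExpanding f p₀ a k y) ≠ 0 := by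
  by_contra! hcon
  have hdim : (t.toNNReal : ℝ≥0∞) < dimH (range fun x => f (x, y)) := by
    refine lt_of_lt_of_le ?_ (hE.trans (conformalDim_le_dimH_range (hf.slice y)))
    have : t.toNNReal < 1 := by simpa using ht1
    exact_mod_cast this
  have htop := hausdorffMeasure_of_lt_dimH hdim
  rw [Real.coe_toNNReal _ ht.le] at htop
  have hnull := measure_union_null
    (hausdorffMeasure_image_contracted_eq_zero (fun x => f (x, y)) ht hat)
    (measure_iUnion_null hcon)
  have hzero : μH[t] (range fun x => f (x, y)) = 0 := by
    refine measure_mono_null ?_ hnull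
    rintro _ ⟨x, rfl⟩
    by_cases hx : x ∈ {x | ∀ n₀, ∃ n ≥ n₀,
        ediam ((fun x => f (x, y)) '' closedEBall x (dyad n)) ≤ dyad n ^ a}
    · exact Or.inl (mem_image_of_mem _ hx)
    · simp only [mem_ofPred_eq] at hx
      push Not at hx
      obtain ⟨n₀, hn₀⟩ := hx
      obtain ⟨m, hm⟩ := exists_nat_ge (dist (x, y) p₀)
      refine Or.inr (mem_iUnion.2 ⟨max n₀ m, mem_image_of_mem _ ⟨?_, fun n hn => ?_⟩⟩)
      · refine mem_closedBall.2 (hm.trans ?_)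
        exact_mod_cast le_max_right _ _
      · exact hn₀ n ((le_max_left _ _).trans hn)
  rw [hzero] at htop
  exact ENNReal.zero_ne_top htop

/-- The point `p'` may lie off the slice. A ball in the slice of radius comparable to `d((x, y),
p')` has image of diameter at most `2 * H * d(f (x, y), f p')` by quasisymmetry, and more than its
radius to the power `a` by expansion. -/
lemma edist_le_of_mem_sliceExpanding {p₀ : E × Y} {a : ℝ} (ha : 0 < a) {k : ℕ} {H : ℝ≥0}
    (hH : ∀ w p p', edist w p ≤ edist p p' → edist (f w) (f p) ≤ H * edist (f p) (f p'))
    {x : E} {y : Y} (hx : x ∈ sliceExpanding f p₀ a k y) {p' : E × Y}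
    (hp : edist (x, y) p' ≤ dyad k) :
    edist (x, y) p' ≤ 2 * (2 * H) ^ a⁻¹ * edist (f (x, y)) (f p') ^ a⁻¹ := by
  by_cases h0 : edist (x, y) p' = 0
  · simp [h0]
  obtain ⟨n, hn1, hn2⟩ := exists_dyad_near h0 (hp.trans (dyad_le_one k))
  have hkn : k ≤ n + 1 := by
    by_contra! h
    exact (hn1.trans_le (hp.trans (dyad_antitone h.le))).false
  have hdiam : ediam ((fun x => f (x, y)) '' closedEBall x (dyad (n + 1))) ≤
      2 * H * edist (f (x, y)) (f p') := by
    have hpt : ∀ w ∈ closedEBall x (dyad (n + 1)),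
        edist (f (w, y)) (f (x, y)) ≤ H * edist (f (x, y)) (f p') := fun w hw => by
      refine hH _ _ _ (le_trans ?_ hn1.le)
      simpa [Prod.edist_eq] using hw
    rw [ediam_image_le_iff]
    intro w hw w' hw'
    calc edist (f (w, y)) (f (w', y))
        ≤ edist (f (w, y)) (f (x, y)) + edist (f (w', y)) (f (x, y)) :=
          edist_triangle_right _ _ _
      _ ≤ H * edist (f (x, y)) (f p') + H * edist (f (x, y)) (f p') :=
          add_le_add (hpt w hw) (hpt w' hw')
      _ = _ := by ring
  have h1 : dyad (n + 1) ≤ (2 * H * edist (f (x, y)) (f p')) ^ a⁻¹ :=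
    (ENNReal.le_rpow_inv_iff ha).2 ((hx.2 _ hkn).le.trans hdiam)
  have h2 : dyad n = 2 * dyad (n + 1) := by
    simpa using dyad_succ_rpow n 1
  rw [mul_assoc, ← ENNReal.mul_rpow_of_nonneg _ _ (inv_nonneg.2 ha.le)]
  exact hn2.trans (h2.le.trans (by gcongr))

/-- The parameters over which the expanding parts of the slices have images of uniformly
positive content form a null set for the Hausdorff measure of the complementary dimension. -/
lemma hausdorffMeasure_setOf_content_ge_eq_zero [MeasurableSpace Y] [BorelSpace Y]
    [MeasurableSpace Z] [BorelSpace Z] (hf : IsQuasisymmetric f) (p₀ : E × Y)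
    {a s t β : ℝ} (ha : 0 < a) (hs : 0 < s) (ht : 0 < t) (hβ : 0 < β) (hq : 0 < t - β + a⁻¹ * s)
    (hnull : μH[t - β + a⁻¹ * s] (range f) = 0) (k : ℕ) {c : ℝ≥0∞} (hc : c ≠ 0) (hct : c ≠ ∞) :
    μH[s] {y | ∀ U : ℕ → Set Z, (fun x => f (x, y)) '' sliceExpanding f p₀ a k y ⊆ ⋃ i, U i →
      c ≤ ∑' i, ediam (U i) ^ t} = 0 := by
  classical
  obtain ⟨H, hH⟩ := hf.exists_edist_le
  -- Image sets smaller than `τ` come from points closer than `2⁻ᵏ`, the scale from which expansion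
  -- is available.
  obtain ⟨τ, hτ0, hτ⟩ := hf.exists_edist_le_of_edist_le
    (isBounded_closedBall (x := p₀) (r := k)) (dyad_ne_zero k)
  obtain ⟨n₀, hn₀⟩ := (dyad_tendsto.eventually_lt_const (pos_iff_ne_zero.2 hτ0)).exists
  set B := ∑' j, dyad j ^ β with hB
  have hBt : B ≠ ∞ := tsum_dyad_rpow_ne_top hβ
  have hB0 : B ≠ 0 := by
    refine (lt_of_lt_of_le ?_ (ENNReal.le_tsum 0)).ne'
    simp [dyad]
  set C : ℝ≥0∞ := 2 * (2 * H) ^ a⁻¹ with hC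
  have hCt : C ≠ ∞ := ENNReal.mul_ne_top (by simp)
    (ENNReal.rpow_ne_top_of_nonneg (inv_nonneg.2 ha.le) (ENNReal.mul_ne_top (by simp) (by simp)))
  set K := (2 * C) ^ s * (c / (2 * B))⁻¹ with hK
  have hKt : K ≠ ∞ := by
    refine ENNReal.mul_ne_top (ENNReal.rpow_ne_top_of_nonneg hs.le
      (ENNReal.mul_ne_top (by simp) hCt)) (ENNReal.inv_ne_top.2 ?_)
    exact (ENNReal.div_pos hc (ENNReal.mul_ne_top (by simp) hBt)).ne'
  refine hausdorffMeasure_eq_zero_of_covers hs fun ε hε => ?_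
  have hε' : min 1 (ε / K) ≠ 0 := (lt_min one_pos (ENNReal.div_pos hε hKt)).ne'
  obtain ⟨U, J, hU, hUJ, hJ, hsum⟩ :=
    exists_dyad_cover_of_hausdorffMeasure_eq_zero hq hnull hε' n₀
  let V : ℕ → Set Y := fun i => {y | ∃ x ∈ sliceExpanding f p₀ a k y, f (x, y) ∈ U i}
  set A := {y | ∀ U : ℕ → Set Z, (fun x => f (x, y)) '' sliceExpanding f p₀ a k y ⊆ ⋃ i, U i →
    c ≤ ∑' i, ediam (U i) ^ t}
  have hV : ∀ i, ediam (V i) ≤ C * dyad (J i) ^ a⁻¹ := by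
    refine fun i => ediam_le ?_
    rintro y ⟨x, hx, hxU⟩ y' ⟨x', hx', hxU'⟩
    have hfd : edist (f (x, y)) (f (x', y')) ≤ dyad (J i) :=
      edist_le_of_ediam_le hxU hxU' (hUJ i)
    have hd : edist (x, y) (x', y') ≤ dyad k :=
      hτ _ hx.1 _ hx'.1 (hfd.trans ((dyad_antitone (hJ i)).trans hn₀.le))
    calc edist y y' ≤ edist (x, y) (x', y') := by rw [Prod.edist_eq]; exact le_max_right _ _
      _ ≤ C * edist (f (x, y)) (f (x', y')) ^ a⁻¹ := edist_le_of_mem_sliceExpanding ha hH hx hd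
      _ ≤ C * dyad (J i) ^ a⁻¹ := by gcongr
  have hA : ∀ y ∈ A, c ≤ ∑' i, (V i).indicator 1 y * dyad (J i) ^ t := by
    intro y hy
    -- Only the sets that meet the expanding part over `y` are kept; the empty ones contribute zero
    -- as `t > 0`.
    refine (hy (fun i => if y ∈ V i then U i else ∅) ?_).trans
      (ENNReal.tsum_le_tsum fun i => ?_)
    · rintro _ ⟨x, hx, rfl⟩
      obtain ⟨i, hi⟩ := mem_iUnion.1 (hU (mem_range_self (x, y)))
      refine mem_iUnion.2 ⟨i, ?_⟩
      rw [if_pos ⟨x, hx, hi⟩]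
      exact hi
    · by_cases h : y ∈ V i
      · simp only [if_pos h, indicator_of_mem h, Pi.one_apply, one_mul]
        exact ENNReal.rpow_le_rpow (hUJ i) ht.le
      · simp [if_neg h, ht]
  obtain ⟨L, W, hW, hWsum⟩ := exists_cover_of_weighted_cover hc hct hs hB.ge hB0 hBt hV hA
    ((hsum.trans (min_le_left _ _)).trans_lt ENNReal.one_lt_top).ne
  refine ⟨_, inferInstance, W, hW, hWsum.trans ?_⟩
  calc K * ∑' i, dyad (J i) ^ (t - β + a⁻¹ * s) ≤ K * (ε / K) := by
        gcongr; exact hsum.trans (min_le_right _ _)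
    _ ≤ ε := ENNReal.mul_div_le

/-- Positive measure means positive content, so countably many choices of the starting scale `k` and
content threshold `1 / (l + 1)` exhaust `Y`. -/
lemma hausdorffMeasure_univ_eq_zero_of_range [MeasurableSpace Y] [BorelSpace Y]
    [MeasurableSpace Z] [BorelSpace Z] (hE : 1 ≤ conformalDim E) (hf : IsQuasisymmetric f)
    (p₀ : E × Y) {a s t β : ℝ} (ha : 0 < a) (hs : 0 < s) (ht : 0 < t) (ht1 : t < 1)
    (hat : 1 < a * t) (hβ : 0 < β) (hq : 0 < t - β + a⁻¹ * s)
    (hnull : μH[t - β + a⁻¹ * s] (range f) = 0) : μH[s] (univ : Set Y) = 0 := by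
  refine measure_mono_null (t := ⋃ (k : ℕ) (l : ℕ), {y | ∀ U : ℕ → Set Z,
    (fun x => f (x, y)) '' sliceExpanding f p₀ a k y ⊆ ⋃ i, U i →
      ((l : ℝ≥0∞) + 1)⁻¹ ≤ ∑' i, ediam (U i) ^ t}) ?_ ?_
  · intro y _
    obtain ⟨k, hk⟩ :=
      exists_hausdorffMeasure_image_sliceExpanding_ne_zero hE hf p₀ ht ht1 hat y
    refine mem_iUnion.2 ⟨k, ?_⟩
    by_contra hcon
    refine hk (hausdorffMeasure_eq_zero_of_covers ht fun ε hε => ?_)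
    obtain ⟨l, hl⟩ := ENNReal.exists_inv_nat_lt hε
    simp only [mem_iUnion, mem_ofPred_eq, not_exists, not_forall, not_le] at hcon
    obtain ⟨U, hU, hsum⟩ := hcon l
    refine ⟨ℕ, inferInstance, U, hU, hsum.le.trans (le_trans ?_ hl.le)⟩
    exact ENNReal.inv_le_inv.2 le_self_add
  · refine measure_iUnion_null fun k => measure_iUnion_null fun l => ?_
    exact hausdorffMeasure_setOf_content_ge_eq_zero hf p₀ ha hs ht hβ hq hnull k
      (by simp) (by simp)

/-- A quasisymmetric image of the product of a set of conformal dimension one with a metric space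
`Y` has at least dimension `1 + dim Y`. -/
lemma one_add_dimH_le_dimH_range [Nonempty Y] (hE : 1 ≤ conformalDim E)
    (hf : IsQuasisymmetric f) : 1 + dimH (univ : Set Y) ≤ dimH (range f) := by
  obtain ⟨y₀⟩ := ‹Nonempty Y›
  have hslice : 1 ≤ dimH (range f) := by
    refine (hE.trans (conformalDim_le_dimH_range (hf.slice y₀))).trans (dimH_mono ?_)
    rintro _ ⟨x, rfl⟩
    exact mem_range_self _
  obtain ⟨x₀⟩ : Nonempty E := by
    by_contra h
    rw [not_nonempty_iff] at h
    rw [range_eq_empty, dimH_empty] at hslice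
    simp at hslice
  by_contra! hlt
  borelize Y
  borelize Z
  obtain ⟨Q, hQ1, hQ2⟩ := ENNReal.lt_iff_exists_nnreal_btwn.1 hlt
  obtain ⟨r, rfl⟩ : ∃ r, Q = 1 + r := by
    have : (1 : ℝ≥0) ≤ Q := by exact_mod_cast hslice.trans hQ1.le
    exact exists_add_of_le this
  have hr : (r : ℝ≥0∞) < dimH (univ : Set Y) := by
    rw [ENNReal.coe_add, ENNReal.coe_one] at hQ2
    exact lt_of_add_lt_add_left hQ2
  obtain ⟨s, hrs, hs⟩ := ENNReal.lt_iff_exists_nnreal_btwn.1 hr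
  have hrs' : (r : ℝ) < s := by exact_mod_cast hrs
  have hr0 : (0 : ℝ) ≤ r := r.2
  have hs0 : (0 : ℝ) < s := hr0.trans_lt hrs'
  -- With `a = 1 + 2δ`, `t = 1 - δ`, `β = δ`: `δ < 1/2` gives `a * t > 1`, and the exponent is at
  -- least `(1 - 2δ)(1 + s) > 1 + r`.
  obtain ⟨δ, hδ0, hδ1, hδ2⟩ : ∃ δ : ℝ, 0 < δ ∧ δ < 1 / 2 ∧ 2 * δ * (1 + s) < s - r := by
    refine ⟨min (1 / 4) ((s - r) / (4 * (1 + s))), lt_min (by norm_num)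
      (div_pos (by linarith) (by linarith)), (min_le_left _ _).trans_lt (by norm_num), ?_⟩
    have h1 := min_le_right (1 / 4) ((s - r) / (4 * (1 + s) : ℝ))
    have h2 : (s - r) / (4 * (1 + s)) * (4 * (1 + s)) = (s - r : ℝ) :=
      div_mul_cancel₀ _ (by positivity)
    nlinarith
  have hb : 1 - 2 * δ ≤ (1 + 2 * δ)⁻¹ := by
    rw [← one_div, le_div_iff₀ (by linarith)]
    nlinarith
  have hq : (1 + r : ℝ) < 1 - δ - δ + (1 + 2 * δ)⁻¹ * s := by nlinarith
  have hnull : μH[1 - δ - δ + (1 + 2 * δ)⁻¹ * s] (range f) = 0 := by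
    have h0 := hausdorffMeasure_of_dimH_lt hQ1
    refine le_antisymm ((Measure.hausdorffMeasure_mono ?_ _).trans h0.le) bot_le
    push_cast
    exact hq.le
  have hzero := hausdorffMeasure_univ_eq_zero_of_range hE hf (x₀, y₀)
    (a := 1 + 2 * δ) (s := s) (t := 1 - δ) (β := δ) (by linarith) hs0 (by linarith) (by linarith)
    (by nlinarith) hδ0 (by linarith) hnull
  rw [hausdorffMeasure_of_lt_dimH hs] at hzero
  exact ENNReal.top_ne_zero hzero

/-- The product of a set `E ⊆ ℝ` of conformal dimension one with any metric space is minimal for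
conformal dimension: neither a measure on `E` nor compactness of `Y` is needed. -/
lemma isMinimalForConformalDim_prod (hE : 1 ≤ conformalDim E) :
    IsMinimalForConformalDim (E × Y) := by
  refine le_antisymm ?_ ?_
  · simpa using conformalDim_le_dimH_range (IsQuasisymmetric.id_self (X := E × Y))
  · cases isEmpty_or_nonempty Y
    · rw [dimH_subsingleton subsingleton_of_subsingleton]
      exact bot_le
    · exact le_iInf₂ fun Z _ => le_iInf₂ fun f hf =>
        (dimH_prod_real_le E).trans (one_add_dimH_le_dimH_range hE hf)

end

end

theorem theoremB (E : Set ℝ) (hE : conformalDim E = 1) (lam : Measure ℝ)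
    (hlam : ∀ ε : ℝ, 0 < ε → ∃ C : ℝ≥0, ∀ x ∈ E, ∀ r : ℝ, 0 < r → r ≤ 1 →
      ENNReal.ofReal (r ^ (1 + ε)) ≤ C * lam (E ∩ Metric.ball x r) ∧
        lam (E ∩ Metric.ball x r) ≤ C * ENNReal.ofReal (r ^ (1 - ε))) :
    (∀ (Y : Type u) [MetricSpace Y] [CompactSpace Y], IsMinimalForConformalDim (E × Y)) ∧
      ∀ (n : ℕ) (Y : Set (EuclideanSpace ℝ (Fin n))), MeasurableSet Y →
        IsMinimalForConformalDim (E × Y) := by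
  exact ⟨fun Y _ _ => isMinimalForConformalDim_prod hE.ge,
    fun n Y _ => isMinimalForConformalDim_prod hE.ge⟩
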